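/- Let $K_G$ denote the (real) Grothendieck constant, i.e. the smallest constant $K$ such that $$\Bigl|\sum_{i,j} T_{ij}\langle x_i,y_j\rangle\Bigr|\le K\,\max_{\varepsilon_i,\nu_j=\pm1}\Bigl|\sum_{i,j}T_{ij}\varepsilon_i\nu_j\Bigr|$$ for all finite real matrices $(T_{ij})$ and all vectors $x_i,y_j$ in the closed unit ball of a real Hilbert space. For a state (density matrix) $\rho$ on $\mathbb{C}^{d_1}\otimes\mathbb{C}^{d_2}\otimes\mathbb{C}^{d_3}$, the largest violation by $\rho$ of a Bell inequality with dichotomic observables is the smallest constant $K\in[0,\infty]$ such that $$\Bigl|\sum_{i,j,k=1}^{M} T_{ijk}\,\mathrm{tr}\bigl(\rho\,(A_i\otimes B_j\otimes C_k)\bigr)\Bigr|\le K\max_{a_i,b_j,c_k=\pm1}\Bigl|\sum_{i,j,k=1}^{M}T_{ijk}a_ib_jc_k\Bigr|$$ for every $M\in\mathbb{N}$, all real coefficients $(T_{ijk})_{i,j,k=1}^M$ and all Hermitian matrices $A_i, B_j, C_k$ on $\mathbb{C}^{d_1},\mathbb{C}^{d_2},\mathbb{C}^{d_3}$, respectively,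 with $-\mathbb{1}\le A_i,B_j,C_k\le\mathbb{1}$. **Theorem (GHZ bound).** For every $n\ge 1$, the largest violation by the tripartite GHZ state $\rho=|\psi\rangle\langle\psi|$, $|\psi\rangle=\frac{1}{\sqrt n}\sum_{i=0}^{n-1}|iii\rangle\in\mathbb{C}^n\otimes\mathbb{C}^n\otimes\mathbb{C}^n$, of a Bell inequality with dichotomic observables is at most $4\sqrt2\,K_G$. In particular, it is bounded independently of $n$. -/

import Mathlib

namespace BellViolation

open scoped Kronecker ENNReal NNReal BigOperators ComplexOrder

/-- The real number `1` or `-1` given by a sign. -/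
def sgn (ε : ℤˣ) : ℝ := ((ε : ℤ) : ℝ)

/-! ### Grothendieck's constant (real scalars) -/

/-- The largest value of `|∑ i j, T i j * ε i * ν j|` over all choices of signs `ε i, ν j = ±1`. -/
noncomputable def signNorm₂ {m n : ℕ} (T : Fin m → Fin n → ℝ) : ℝ :=
  ⨆ s : (Fin m → ℤˣ) × (Fin n → ℤˣ), |∑ i, ∑ j, T i j * sgn (s.1 i) * sgn (s.2 j)|

/-- `K` is admissible in Grothendieck's inequality: for all finite real matrices `T` and all
vectors `x i`, `y j` in the unit ball of a real Hilbert space,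
`|∑ i j, T i j ⟪x i, y j⟫|` is at most `K` times the maximum over signs. -/
def IsGrothendieckBound (K : ℝ) : Prop :=
  ∀ (m n : ℕ) (T : Fin m → Fin n → ℝ)
    (H : Type) [NormedAddCommGroup H] [InnerProductSpace ℝ H] [CompleteSpace H]
    (x : Fin m → H) (y : Fin n → H),
    (∀ i, ‖x i‖ ≤ 1) → (∀ j, ‖y j‖ ≤ 1) →
      |∑ i, ∑ j, T i j * inner ℝ (x i) (y j)| ≤ K * signNorm₂ T

/-- Grothendieck's constant `K_G`: the best constant in Grothendieck's inequality. -/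
noncomputable def grothendieckConstant : ℝ :=
  sInf {K : ℝ | IsGrothendieckBound K}

/-! ### Tripartite Bell inequalities -/

/-- The classical (local hidden variable) bound `‖T‖` of the Bell inequality with coefficients `T`:
the largest value of `|∑ i j k, T i j k * a i * b j * c k|` over signs `a i, b j, c k = ±1`. -/
noncomputable def classicalBound {M : ℕ} (T : Fin M → Fin M → Fin M → ℝ) : ℝ :=
  ⨆ s : (Fin M → ℤˣ) × (Fin M → ℤˣ) × (Fin M → ℤˣ),
    |∑ i, ∑ j, ∑ k, T i j k * sgn (s.1 i) * sgn (s.2.1 j) * sgn (s.2.2 k)|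

/-- A dichotomic (`±1`-valued) observable in the POVM framework: a Hermitian matrix with
`-1 ≤ A ≤ 1`. -/
def IsDichotomic {d : ℕ} (A : Matrix (Fin d) (Fin d) ℂ) : Prop :=
  A.IsHermitian ∧ (1 - A).PosSemidef ∧ (1 + A).PosSemidef

/-- The quantum correlation `tr (ρ (A ⊗ B ⊗ C))`. -/
noncomputable def correlation {d₁ d₂ d₃ : ℕ}
    (ρ : Matrix (Fin d₁ × Fin d₂ × Fin d₃) (Fin d₁ × Fin d₂ × Fin d₃) ℂ)
    (A : Matrix (Fin d₁) (Fin d₁) ℂ) (B : Matrix (Fin d₂) (Fin d₂) ℂ)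
    (C : Matrix (Fin d₃) (Fin d₃) ℂ) : ℂ :=
  (ρ * (A ⊗ₖ (B ⊗ₖ C))).trace

/-- No Bell inequality (any number `M` of dichotomic observables per party, any real coefficients
`T`) is violated by the state `ρ` by more than a factor `K`. -/
def IsViolationBound {d₁ d₂ d₃ : ℕ}
    (ρ : Matrix (Fin d₁ × Fin d₂ × Fin d₃) (Fin d₁ × Fin d₂ × Fin d₃) ℂ) (K : ℝ) : Prop :=
  ∀ (M : ℕ) (T : Fin M → Fin M → Fin M → ℝ)
    (A : Fin M → Matrix (Fin d₁) (Fin d₁) ℂ) (B : Fin M → Matrix (Fin d₂) (Fin d₂) ℂ)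
    (C : Fin M → Matrix (Fin d₃) (Fin d₃) ℂ),
    (∀ i, IsDichotomic (A i)) → (∀ j, IsDichotomic (B j)) → (∀ k, IsDichotomic (C k)) →
      ‖∑ i, ∑ j, ∑ k, (T i j k : ℂ) * correlation ρ (A i) (B j) (C k)‖ ≤ K * classicalBound T

/-- The largest violation of a Bell inequality with dichotomic observables that the state `ρ` can
produce: the smallest `K` bounding all violations, and `∞` if there is none. -/
noncomputable def largestViolation {d₁ d₂ d₃ : ℕ}
    (ρ : Matrix (Fin d₁ × Fin d₂ × Fin d₃) (Fin d₁ × Fin d₂ × Fin d₃) ℂ) : ℝ≥0∞ :=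
  ⨅ (K : ℝ≥0) (_ : IsViolationBound ρ (K : ℝ)), (K : ℝ≥0∞)

/-- The GHZ vector `(1/√n) ∑ i, |i i i⟩` in `ℂⁿ ⊗ ℂⁿ ⊗ ℂⁿ`, in coordinates. -/
noncomputable def ghzVector (n : ℕ) : Fin n × Fin n × Fin n → ℂ :=
  ((1 / Real.sqrt n : ℝ) : ℂ) • ∑ i : Fin n, Pi.single (i, i, i) (1 : ℂ)

/-- The GHZ state `|ψ⟩⟨ψ|` as a density matrix. -/
noncomputable def ghzState (n : ℕ) :
    Matrix (Fin n × Fin n × Fin n) (Fin n × Fin n × Fin n) ℂ :=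
  Matrix.vecMulVec (ghzVector n) (star (ghzVector n))

end BellViolation

/-! The GHZ vector lives on the diagonal triples, so its correlations are `n⁻¹ * ∑ r, ∑ a, A r a * B
r a * C r a` (`correlation_ghzState`). Rows of a dichotomic observable lie in the unit ball of
complex `ℓ₂` (`IsDichotomic.row_norm_le`), so for each `r` it suffices to bound the trilinear form
`∑ a, x a * y a * z a` on that ball (`norm_trilinear_le`).

Cauchy–Schwarz removes `z`, leaving a sum over `k` of `ℓ₂` norms of contracted vectors. Khintchine's
inequality replaces each norm by an average of `|∑ a, ε a * R k a|`. For fixed `ε` the signs are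
absorbed into `x`, and Grothendieck's inequality bounds the sum over `k` (`sum_abs_contract_le`).
Real and imaginary parts each cost `16/9`, and `32/9 ≤ 4`.

Since `K_G` is defined as an infimum, some finite constant must first be shown admissible; a
truncation argument with Rademacher sums gives `8`. -/

namespace BellViolation

open scoped Kronecker ENNReal NNReal BigOperators ComplexOrder

/-! ### Moments of Rademacher sums -/

/-- The Rademacher sum `∑ a, ε a * r a`. -/
noncomputable def radSum {d : ℕ} (r : Fin d → ℝ) (ε : Fin d → ℤˣ) : ℝ := ∑ a, sgn (ε a) * r a

lemma abs_sgn (e : ℤˣ) : |sgn e| = 1 := by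
  rcases Int.units_eq_one_or e with rfl | rfl <;> simp [sgn]

lemma sgn_mul_self (e : ℤˣ) : sgn e * sgn e = 1 := by
  rcases Int.units_eq_one_or e with rfl | rfl <;> simp [sgn]

lemma sum_signs_succ {d : ℕ} (F : (Fin (d + 1) → ℤˣ) → ℝ) :
    ∑ ε, F ε = ∑ ε : Fin d → ℤˣ, (F (Fin.cons 1 ε) + F (Fin.cons (-1) ε)) := by
  rw [← (Fin.consEquiv fun _ : Fin (d + 1) => ℤˣ).sum_comp, Fintype.sum_prod_type,
    Finset.sum_add_distrib]
  have h : (Finset.univ : Finset ℤˣ) = {1, -1} := by decide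
  rw [h, Finset.sum_pair (by decide)]
  rfl

lemma radSum_cons {d : ℕ} (r : Fin (d + 1) → ℝ) (e : ℤˣ) (ε : Fin d → ℤˣ) :
    radSum r (Fin.cons e ε) = sgn e * r 0 + radSum (fun a => r a.succ) ε := by
  simp [radSum, Fin.sum_univ_succ]

lemma sgn_one : sgn 1 = 1 := by simp [sgn]

lemma sgn_neg_one : sgn (-1) = -1 := by simp [sgn]

/-- Second moment of a Rademacher sum. -/
lemma sum_radSum_sq {d : ℕ} (r : Fin d → ℝ) :
    ∑ ε, radSum r ε ^ 2 = 2 ^ d * ∑ a, r a ^ 2 := by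
  induction d with
  | zero => simp [radSum]
  | succ d ih =>
    have h : ∀ ε : Fin d → ℤˣ, radSum r (Fin.cons 1 ε) ^ 2 + radSum r (Fin.cons (-1) ε) ^ 2
        = 2 * radSum (fun a => r a.succ) ε ^ 2 + 2 * r 0 ^ 2 := by
      intro ε
      rw [radSum_cons, radSum_cons, sgn_one, sgn_neg_one]
      ring
    rw [sum_signs_succ, Finset.sum_congr rfl fun ε _ => h ε, Finset.sum_add_distrib,
      ← Finset.mul_sum, ih, Fin.sum_univ_succ]
    simp
    ring

/-- Polarized second moment of Rademacher sums. -/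
lemma sum_radSum_mul {d : ℕ} (r s : Fin d → ℝ) :
    ∑ ε, radSum r ε * radSum s ε = 2 ^ d * ∑ a, r a * s a := by
  have h1 := sum_radSum_sq fun a => r a + s a
  have h2 := sum_radSum_sq fun a => r a - s a
  have ha : ∀ ε, radSum (fun a => r a + s a) ε = radSum r ε + radSum s ε := fun ε => by
    simp [radSum, mul_add, Finset.sum_add_distrib]
  have hs : ∀ ε, radSum (fun a => r a - s a) ε = radSum r ε - radSum s ε := fun ε => by
    simp [radSum, mul_sub, Finset.sum_sub_distrib]
  simp only [ha] at h1
  simp only [hs] at h2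
  have e1 : ∑ ε, radSum r ε * radSum s ε =
      (∑ ε, (radSum r ε + radSum s ε) ^ 2 - ∑ ε, (radSum r ε - radSum s ε) ^ 2) / 4 := by
    rw [← Finset.sum_sub_distrib, Finset.sum_div]
    exact Finset.sum_congr rfl fun _ _ => by ring
  have e2 : ∑ a, r a * s a = (∑ a, (r a + s a) ^ 2 - ∑ a, (r a - s a) ^ 2) / 4 := by
    rw [← Finset.sum_sub_distrib, Finset.sum_div]
    exact Finset.sum_congr rfl fun _ _ => by ring
  rw [e1, e2, h1, h2]
  ring

/-- Fourth moment of a Rademacher sum. -/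
lemma sum_radSum_pow_four_le {d : ℕ} (r : Fin d → ℝ) :
    ∑ ε, radSum r ε ^ 4 ≤ 2 ^ d * (3 * (∑ a, r a ^ 2) ^ 2) := by
  induction d with
  | zero => simp [radSum]
  | succ d ih =>
    have h : ∀ ε : Fin d → ℤˣ, radSum r (Fin.cons 1 ε) ^ 4 + radSum r (Fin.cons (-1) ε) ^ 4
        = 2 * radSum (fun a => r a.succ) ε ^ 4
          + 12 * r 0 ^ 2 * radSum (fun a => r a.succ) ε ^ 2 + 2 * r 0 ^ 4 := by
      intro ε
      rw [radSum_cons, radSum_cons, sgn_one, sgn_neg_one]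
      ring
    rw [sum_signs_succ, Finset.sum_congr rfl fun ε _ => h ε, Finset.sum_add_distrib,
      Finset.sum_add_distrib, ← Finset.mul_sum, ← Finset.mul_sum, sum_radSum_sq,
      Fin.sum_univ_succ]
    have h1 := ih fun a => r a.succ
    have h2 : (0 : ℝ) ≤ 2 ^ d * r 0 ^ 4 := by positivity
    simp only [Finset.sum_const, Finset.card_univ, Fintype.card_fun, Fintype.card_units_int,
      Fintype.card_fin, nsmul_eq_mul, Nat.cast_pow, Nat.cast_ofNat]
    rw [pow_succ (2 : ℝ)]
    nlinarith

/-- Khintchine's inequality between the first and the second moment of a Rademacher sum. -/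
lemma khintchine {d : ℕ} (r : Fin d → ℝ) :
    2 ^ d * (9 / 16 * √(∑ a, r a ^ 2)) ≤ ∑ ε, |radSum r ε| := by
  set σ := √(∑ a, r a ^ 2) with hσ
  have hσ2 : σ ^ 2 = ∑ a, r a ^ 2 := Real.sq_sqrt (Finset.sum_nonneg fun _ _ => sq_nonneg _)
  have hσ0 : 0 ≤ σ := Real.sqrt_nonneg _
  rcases hσ0.eq_or_lt with h0 | hpos
  · rw [← h0]
    simpa using Finset.sum_nonneg fun ε _ => abs_nonneg (radSum r ε)
  -- This is `t * (t - 2σ)² * (t + 4σ) ≥ 0` expanded, with `t = |radSum r ε|`. Averaging with second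
  -- moment `σ²` and fourth moment at most `3σ⁴` leaves `(12 - 3)/16 = 9/16`.
  have hpt : ∀ ε, 12 * σ ^ 2 * radSum r ε ^ 2 - radSum r ε ^ 4 ≤ 16 * σ ^ 3 * |radSum r ε| := by
    intro ε
    have ht := abs_nonneg (radSum r ε)
    rw [← sq_abs (radSum r ε), ← Even.pow_abs (by decide : Even 4)]
    generalize |radSum r ε| = t at ht
    have : 0 ≤ t * ((t - 2 * σ) ^ 2 * (t + 4 * σ)) := by positivity
    nlinarith
  have hsum := Finset.sum_le_sum fun ε (_ : ε ∈ Finset.univ) => hpt ε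
  rw [Finset.sum_sub_distrib, ← Finset.mul_sum, ← Finset.mul_sum, sum_radSum_sq, ← hσ2] at hsum
  have h4 := sum_radSum_pow_four_le r
  rw [← hσ2] at h4
  have h3 : 0 < 16 * σ ^ 3 := by positivity
  refine le_of_mul_le_mul_left ?_ h3
  nlinarith

/-! ### Values on the cube are bounded by values on signs -/

/-- A linear form on the cube is largest at a vertex, the one matching the signs of the
coefficients. -/
lemma abs_linear_le_of_signs {m : ℕ} (L : Fin m → ℝ) (C : ℝ)
    (h : ∀ s : Fin m → ℤˣ, |∑ i, sgn (s i) * L i| ≤ C) (t : Fin m → ℝ) (ht : ∀ i, |t i| ≤ 1) :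
    |∑ i, t i * L i| ≤ C := by
  have hs : ∀ x : ℝ, ∃ e : ℤˣ, sgn e * x = |x| := by
    intro x
    rcases le_total 0 x with hx | hx
    · exact ⟨1, by rw [sgn_one, one_mul, abs_of_nonneg hx]⟩
    · exact ⟨-1, by rw [sgn_neg_one, abs_of_nonpos hx]; ring⟩
  choose e he using hs
  calc |∑ i, t i * L i| ≤ ∑ i, |t i * L i| := Finset.abs_sum_le_sum_abs _ _
    _ ≤ ∑ i, |L i| := Finset.sum_le_sum fun i _ => by
        rw [abs_mul]
        exact mul_le_of_le_one_left (abs_nonneg _) (ht i)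
    _ = ∑ i, sgn (e (L i)) * L i := Finset.sum_congr rfl fun i _ => (he _).symm
    _ ≤ C := (le_abs_self _).trans (h _)

lemma sum_abs_le_of_signs {m : ℕ} (L : Fin m → ℝ) (C : ℝ)
    (h : ∀ s : Fin m → ℤˣ, |∑ i, sgn (s i) * L i| ≤ C) : ∑ i, |L i| ≤ C := by
  -- `SignType.sign` takes the value 0, so the cube version is what applies.
  have h1 := abs_linear_le_of_signs L C h (fun i => SignType.sign (L i)) fun i => by
    rcases lt_trichotomy (L i) 0 with h | h | h <;> simp [h]
  refine (le_of_eq ?_).trans ((le_abs_self _).trans h1)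
  exact Finset.sum_congr rfl fun i _ => (sign_mul_self _).symm

lemma signNorm₂_ge {m n : ℕ} (T : Fin m → Fin n → ℝ) (s : Fin m → ℤˣ) (t : Fin n → ℤˣ) :
    |∑ i, ∑ j, T i j * sgn (s i) * sgn (t j)| ≤ signNorm₂ T :=
  le_ciSup (f := fun s : (Fin m → ℤˣ) × (Fin n → ℤˣ) =>
    |∑ i, ∑ j, T i j * sgn (s.1 i) * sgn (s.2 j)|) (Set.finite_range _).bddAbove (s, t)

lemma signNorm₂_nonneg {m n : ℕ} (T : Fin m → Fin n → ℝ) : 0 ≤ signNorm₂ T :=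
  (abs_nonneg _).trans (signNorm₂_ge T 1 1)

lemma abs_bilinear_le_signNorm₂ {m n : ℕ} (T : Fin m → Fin n → ℝ) (s : Fin m → ℝ) (t : Fin n → ℝ)
    (hs : ∀ i, |s i| ≤ 1) (ht : ∀ j, |t j| ≤ 1) :
    |∑ i, ∑ j, T i j * (s i * t j)| ≤ signNorm₂ T := by
  have e1 : ∑ i, ∑ j, T i j * (s i * t j) = ∑ i, s i * ∑ j, T i j * t j := by
    simp only [Finset.mul_sum]
    exact Finset.sum_congr rfl fun i _ => Finset.sum_congr rfl fun j _ => by ring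
  rw [e1]
  refine abs_linear_le_of_signs _ _ (fun ε => ?_) s hs
  have e2 : ∑ i, sgn (ε i) * ∑ j, T i j * t j = ∑ j, t j * ∑ i, T i j * sgn (ε i) := by
    simp only [Finset.mul_sum]
    rw [Finset.sum_comm]
    exact Finset.sum_congr rfl fun i _ => Finset.sum_congr rfl fun j _ => by ring
  rw [e2]
  refine abs_linear_le_of_signs _ _ (fun ν => ?_) t ht
  refine (le_of_eq ?_).trans (signNorm₂_ge T ε ν)
  congr 1
  simp only [Finset.mul_sum]
  rw [Finset.sum_comm]
  exact Finset.sum_congr rfl fun i _ => Finset.sum_congr rfl fun j _ => by ring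

/-! ### Grothendieck's inequality -/

/-- `B` bounds the bilinear form of `T` on the unit balls of all finite dimensional Euclidean
spaces. -/
def IsEuclideanBound {m n : ℕ} (T : Fin m → Fin n → ℝ) (B : ℝ) : Prop :=
  ∀ (ι : Type) [Fintype ι] (x : Fin m → ι → ℝ) (y : Fin n → ι → ℝ),
    (∀ i, ∑ a, x i a ^ 2 ≤ 1) → (∀ j, ∑ a, y j a ^ 2 ≤ 1) →
      |∑ i, ∑ j, T i j * ∑ a, x i a * y j a| ≤ B

lemma abs_sum_mul_le_of_sq {ι : Type*} [Fintype ι] (x y : ι → ℝ) (hx : ∑ a, x a ^ 2 ≤ 1)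
    (hy : ∑ a, y a ^ 2 ≤ 1) : |∑ a, x a * y a| ≤ 1 := by
  rw [← sq_le_one_iff_abs_le_one]
  exact (Finset.sum_mul_sq_le_sq_mul_sq _ _ _).trans
    (mul_le_one₀ hx (Finset.sum_nonneg fun _ _ => sq_nonneg _) hy)

/-- A crude finite bound, needed so that the best bound exists and can be absorbed later. -/
lemma isEuclideanBound_sum_abs {m n : ℕ} (T : Fin m → Fin n → ℝ) :
    IsEuclideanBound T (∑ i, ∑ j, |T i j|) := by
  intro ι _ x y hx hy
  refine (Finset.abs_sum_le_sum_abs _ _).trans (Finset.sum_le_sum fun i _ => ?_)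
  refine (Finset.abs_sum_le_sum_abs _ _).trans (Finset.sum_le_sum fun j _ => ?_)
  rw [abs_mul]
  exact mul_le_of_le_one_right (abs_nonneg _) (abs_sum_mul_le_of_sq _ _ (hx i) (hy j))

lemma IsEuclideanBound.scaled {m n : ℕ} {T : Fin m → Fin n → ℝ} {B : ℝ} (h : IsEuclideanBound T B)
    {ι : Type} [Fintype ι] (x : Fin m → ι → ℝ) (y : Fin n → ι → ℝ) {p q : ℝ} (hp : 0 < p)
    (hq : 0 < q) (hx : ∀ i, ∑ a, x i a ^ 2 ≤ p ^ 2) (hy : ∀ j, ∑ a, y j a ^ 2 ≤ q ^ 2) :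
    |∑ i, ∑ j, T i j * ∑ a, x i a * y j a| ≤ p * q * B := by
  have h1 := h ι (fun i a => x i a / p) (fun j a => y j a / q)
    (fun i => by
      simp only [div_pow]
      rw [← Finset.sum_div]
      exact div_le_one_of_le₀ (hx i) (by positivity))
    (fun j => by
      simp only [div_pow]
      rw [← Finset.sum_div]
      exact div_le_one_of_le₀ (hy j) (by positivity))
  have e : ∑ i, ∑ j, T i j * ∑ a, x i a * y j a
      = p * q * ∑ i, ∑ j, T i j * ∑ a, x i a / p * (y j a / q) := by
    simp only [Finset.mul_sum]
    refine Finset.sum_congr rfl fun i _ => Finset.sum_congr rfl fun j _ =>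
      Finset.sum_congr rfl fun a _ => ?_
    field_simp
  rw [e, abs_mul, abs_of_pos (by positivity : 0 < p * q)]
  exact mul_le_mul_of_nonneg_left h1 (by positivity)

/-- Truncation of a real number to `[-1, 1]`. -/
noncomputable def clamp (t : ℝ) : ℝ := max (-1) (min 1 t)

lemma abs_clamp_le (t : ℝ) : |clamp t| ≤ 1 :=
  abs_le.2 ⟨le_max_left _ _, max_le (by norm_num) (min_le_left _ _)⟩

lemma clamp_sq_le (t : ℝ) : clamp t ^ 2 ≤ t ^ 2 := by
  unfold clamp
  rcases le_total 1 t with h | h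
  · rw [min_eq_left h, max_eq_right (by norm_num)]
    nlinarith
  · rw [min_eq_right h]
    rcases le_total (-1) t with h' | h'
    · rw [max_eq_right h']
    · rw [max_eq_left h']
      nlinarith

/-- For `t ≥ 1` this rests on `t - 1 ≤ t²/4`, that is `(t - 2)² ≥ 0`. The truncation error is thus
controlled by the fourth moment. -/
lemma sub_clamp_sq_le (t : ℝ) : (t - clamp t) ^ 2 ≤ t ^ 4 / 16 := by
  have h : |t - clamp t| ≤ t ^ 2 / 4 := by
    unfold clamp
    rw [abs_le]
    rcases le_total 1 t with h | h
    · rw [min_eq_left h, max_eq_right (by norm_num)]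
      constructor <;> nlinarith [sq_nonneg (t - 2)]
    · rw [min_eq_right h]
      rcases le_total (-1) t with h' | h'
      · rw [max_eq_right h']
        constructor <;> nlinarith
      · rw [max_eq_left h']
        constructor <;> nlinarith [sq_nonneg (t + 2)]
  rw [← sq_abs]
  calc |t - clamp t| ^ 2 ≤ (t ^ 2 / 4) ^ 2 := by gcongr
    _ = t ^ 4 / 16 := by ring

/-- Inner products are averages of products of Rademacher sums `X * Y`. Split `X * Y` as `clamp X *
clamp Y + clamp X * (Y - clamp Y) + (X - clamp X) * Y`: the first term is bounded by signs, and `B`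
itself bounds the other two, each with one factor of small `L₂` norm. -/
lemma IsEuclideanBound.improve_fin {m n : ℕ} {T : Fin m → Fin n → ℝ} {B : ℝ}
    (h : IsEuclideanBound T B) {d : ℕ} (x : Fin m → Fin d → ℝ) (y : Fin n → Fin d → ℝ)
    (hx : ∀ i, ∑ a, x i a ^ 2 ≤ 1) (hy : ∀ j, ∑ a, y j a ^ 2 ≤ 1) :
    |∑ i, ∑ j, T i j * ∑ a, x i a * y j a| ≤ signNorm₂ T + 7 / 8 * B := by
  set D : ℝ := 2 ^ d with hD
  have hD0 : 0 < D := by positivity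
  set p := √D with hp
  have hp2 : p ^ 2 = D := Real.sq_sqrt hD0.le
  have hp0 : 0 < p := Real.sqrt_pos.2 hD0
  have second : ∀ r : Fin d → ℝ, ∑ a, r a ^ 2 ≤ 1 → ∑ ε, radSum r ε ^ 2 ≤ p ^ 2 := by
    intro r hr
    rw [sum_radSum_sq, hp2]
    exact mul_le_of_le_one_right hD0.le hr
  have second' : ∀ r : Fin d → ℝ, ∑ a, r a ^ 2 ≤ 1 → ∑ ε, clamp (radSum r ε) ^ 2 ≤ p ^ 2 :=
    fun r hr => (Finset.sum_le_sum fun ε _ => clamp_sq_le _).trans (second r hr)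
  have fourth : ∀ r : Fin d → ℝ, ∑ a, r a ^ 2 ≤ 1 →
      -- The mean square error is at most `3/16 = 48/256 ≤ (7/16)²`.
      ∑ ε, (radSum r ε - clamp (radSum r ε)) ^ 2 ≤ (7 / 16 * p) ^ 2 := by
    intro r hr
    refine (Finset.sum_le_sum fun ε _ => sub_clamp_sq_le _).trans ?_
    rw [← Finset.sum_div, mul_pow, hp2]
    have h4 := sum_radSum_pow_four_le r
    have hr0 : 0 ≤ ∑ a, r a ^ 2 := Finset.sum_nonneg fun _ _ => sq_nonneg _
    have h5 : (∑ a, r a ^ 2) ^ 2 ≤ 1 := pow_le_one₀ hr0 hr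
    have h6 : D * (∑ a, r a ^ 2) ^ 2 ≤ D := mul_le_of_le_one_right hD0.le h5
    rw [← hD] at h4
    linarith
  have b1 : |∑ i, ∑ j, T i j * ∑ ε, clamp (radSum (x i) ε) * clamp (radSum (y j) ε)|
      ≤ D * signNorm₂ T := by
    have e : ∑ i, ∑ j, T i j * ∑ ε, clamp (radSum (x i) ε) * clamp (radSum (y j) ε)
        = ∑ ε, ∑ i, ∑ j, T i j * (clamp (radSum (x i) ε) * clamp (radSum (y j) ε)) := by
      simp only [Finset.mul_sum]
      rw [Finset.sum_comm]
      simp only [Finset.sum_comm (s := (Finset.univ : Finset (Fin m)))]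
      rw [Finset.sum_comm]
    rw [e]
    refine (Finset.abs_sum_le_sum_abs _ _).trans ?_
    refine (Finset.sum_le_sum fun ε _ => abs_bilinear_le_signNorm₂ T
      (fun i => clamp (radSum (x i) ε)) (fun j => clamp (radSum (y j) ε))
      (fun _ => abs_clamp_le _) fun _ => abs_clamp_le _).trans ?_
    simp [hD]
  have b2 := h.scaled (fun i ε => clamp (radSum (x i) ε))
    (fun j ε => radSum (y j) ε - clamp (radSum (y j) ε)) hp0 (by positivity : 0 < 7 / 16 * p)
    (fun i => second' _ (hx i)) fun j => fourth _ (hy j)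
  have b3 := h.scaled (fun i ε => radSum (x i) ε - clamp (radSum (x i) ε))
    (fun j ε => radSum (y j) ε) (by positivity : 0 < 7 / 16 * p) hp0
    (fun i => fourth _ (hx i)) fun j => second _ (hy j)
  have key : D * ∑ i, ∑ j, T i j * ∑ a, x i a * y j a =
      (∑ i, ∑ j, T i j * ∑ ε, clamp (radSum (x i) ε) * clamp (radSum (y j) ε))
      + (∑ i, ∑ j, T i j * ∑ ε, clamp (radSum (x i) ε) *
          (radSum (y j) ε - clamp (radSum (y j) ε)))
      + ∑ i, ∑ j, T i j * ∑ ε, (radSum (x i) ε - clamp (radSum (x i) ε)) * radSum (y j) ε := by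
    rw [Finset.mul_sum, ← Finset.sum_add_distrib, ← Finset.sum_add_distrib]
    refine Finset.sum_congr rfl fun i _ => ?_
    rw [Finset.mul_sum, ← Finset.sum_add_distrib, ← Finset.sum_add_distrib]
    refine Finset.sum_congr rfl fun j _ => ?_
    rw [mul_left_comm, hD, ← sum_radSum_mul, ← mul_add, ← mul_add, ← Finset.sum_add_distrib,
      ← Finset.sum_add_distrib]
    congr 1
    exact Finset.sum_congr rfl fun ε _ => by ring
  have : D * |∑ i, ∑ j, T i j * ∑ a, x i a * y j a| ≤ D * (signNorm₂ T + 7 / 8 * B) := by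
    rw [← abs_of_pos hD0, ← abs_mul, abs_of_pos hD0, key]
    refine (abs_add_three _ _ _).trans ?_
    have : p * (7 / 16 * p) * B = D * (7 / 16 * B) := by rw [← hp2]; ring
    have : 7 / 16 * p * p * B = D * (7 / 16 * B) := by rw [← hp2]; ring
    linarith
  exact le_of_mul_le_mul_left this hD0

lemma IsEuclideanBound.improve {m n : ℕ} {T : Fin m → Fin n → ℝ} {B : ℝ}
    (h : IsEuclideanBound T B) : IsEuclideanBound T (signNorm₂ T + 7 / 8 * B) := by
  intro ι _ x y hx hy
  let e := (Fintype.equivFin ι).symm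
  have h1 := h.improve_fin (fun i a => x i (e a)) (fun j a => y j (e a))
    (fun i => by rw [e.sum_comp fun a => x i a ^ 2]; exact hx i)
    (fun j => by rw [e.sum_comp fun a => y j a ^ 2]; exact hy j)
  have e1 : ∀ i j, ∑ a, x i (e a) * y j (e a) = ∑ a, x i a * y j a :=
    fun i j => e.sum_comp fun a => x i a * y j a
  simpa only [e1] using h1

/-- Grothendieck's inequality in Euclidean spaces. -/
theorem isEuclideanBound_signNorm₂ {m n : ℕ} (T : Fin m → Fin n → ℝ) :
    IsEuclideanBound T (8 * signNorm₂ T) := by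
  have hne : {B | IsEuclideanBound T B}.Nonempty := ⟨_, isEuclideanBound_sum_abs T⟩
  have hbd : BddBelow {B | IsEuclideanBound T B} := ⟨0, fun B hB =>
    (abs_nonneg _).trans (hB Empty (fun _ _ => 0) (fun _ _ => 0) (by simp) (by simp))⟩
  have hmem : IsEuclideanBound T (sInf {B | IsEuclideanBound T B}) :=
    fun ι _ x y hx hy => le_csInf hne fun B hB => hB ι x y hx hy
  -- The least bound `B` satisfies `B ≤ signNorm₂ T + 7/8 * B`, hence `B ≤ 8 * signNorm₂ T`.
  have h8 := csInf_le hbd hmem.improve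
  intro ι _ x y hx hy
  refine (hmem ι x y hx hy).trans ?_
  linarith

/-- Grothendieck's inequality holds with some finite constant. -/
theorem isGrothendieckBound_eight : IsGrothendieckBound 8 := by
  intro m n T H _ _ _ x y hx hy
  let W : Submodule ℝ H := Submodule.span ℝ (Set.range x ∪ Set.range y)
  have : FiniteDimensional ℝ W :=
    FiniteDimensional.span_of_finite ℝ ((Set.finite_range x).union (Set.finite_range y))
  let b := stdOrthonormalBasis ℝ W
  let x' : Fin m → W := fun i => ⟨x i, Submodule.subset_span (Or.inl ⟨i, rfl⟩)⟩
  let y' : Fin n → W := fun j => ⟨y j, Submodule.subset_span (Or.inr ⟨j, rfl⟩)⟩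
  have hsq : ∀ w : W, ‖w‖ ≤ 1 → ∑ a, (inner ℝ w (b a)) ^ 2 ≤ 1 := by
    intro w hw
    have h1 := b.sum_inner_mul_inner w w
    rw [real_inner_self_eq_norm_sq] at h1
    calc ∑ a, (inner ℝ w (b a)) ^ 2 = ∑ a, inner ℝ w (b a) * inner ℝ (b a) w :=
          Finset.sum_congr rfl fun a _ => by rw [real_inner_comm w (b a), sq]
      _ = ‖w‖ ^ 2 := h1
      _ ≤ 1 := pow_le_one₀ (norm_nonneg _) hw
  have h := isEuclideanBound_signNorm₂ T _ (fun i a => inner ℝ (x' i) (b a))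
    (fun j a => inner ℝ (y' j) (b a)) (fun i => hsq _ (hx i)) (fun j => hsq _ (hy j))
  have e : ∀ i j, ∑ a, inner ℝ (x' i) (b a) * inner ℝ (y' j) (b a) = inner ℝ (x i) (y j) := by
    intro i j
    have h1 := b.sum_inner_mul_inner (x' i) (y' j)
    rw [← Submodule.coe_inner W (x' i) (y' j), ← h1]
    exact Finset.sum_congr rfl fun a _ => by rw [real_inner_comm (y' j) (b a)]
  simpa only [e] using h

lemma one_le_of_isGrothendieckBound {K : ℝ} (hK : IsGrothendieckBound K) : 1 ≤ K := by
  have h := hK 1 1 (fun _ _ => 1) ℝ (fun _ => 1) (fun _ => 1) (by simp) (by simp)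
  have h1 : signNorm₂ (fun _ _ => 1 : Fin 1 → Fin 1 → ℝ) = 1 := by
    simp [signNorm₂, abs_mul, abs_sgn]
  rw [h1] at h
  simpa using h

lemma grothendieckConstant_nonneg : 0 ≤ grothendieckConstant :=
  Real.sInf_nonneg fun _ hK => zero_le_one.trans (one_le_of_isGrothendieckBound hK)

/-- Grothendieck's constant is itself admissible in Grothendieck's inequality. -/
theorem isGrothendieckBound_grothendieckConstant : IsGrothendieckBound grothendieckConstant := by
  intro m n T H _ _ _ x y hx hy
  -- If the sign norm vanishes one cannot divide by it, but the constant 8 already forces the form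
  -- to be zero.
  rcases (signNorm₂_nonneg T).eq_or_lt with h0 | hpos
  · have := isGrothendieckBound_eight m n T H x y hx hy
    rwa [← h0, mul_zero] at this ⊢
  · rw [← div_le_iff₀ hpos]
    refine le_csInf ⟨8, isGrothendieckBound_eight⟩ fun K hK => ?_
    rw [div_le_iff₀ hpos]
    exact hK m n T H x y hx hy

lemma isEuclideanBound_grothendieckConstant {m n : ℕ} (T : Fin m → Fin n → ℝ) :
    IsEuclideanBound T (grothendieckConstant * signNorm₂ T) := by
  intro ι _ x y hx hy
  have hn : ∀ r : ι → ℝ, ∑ a, r a ^ 2 ≤ 1 → ‖WithLp.toLp 2 r‖ ≤ 1 := by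
    intro r hr
    rw [EuclideanSpace.norm_eq]
    exact Real.sqrt_le_one.2 (by simpa using hr)
  have h := isGrothendieckBound_grothendieckConstant m n T (EuclideanSpace ℝ ι)
    (fun i => WithLp.toLp 2 (x i)) (fun j => WithLp.toLp 2 (y j)) (fun i => hn _ (hx i))
    (fun j => hn _ (hy j))
  have e : ∀ i j, inner ℝ (WithLp.toLp 2 (x i) : EuclideanSpace ℝ ι) (WithLp.toLp 2 (y j))
      = ∑ a, x i a * y j a := by
    intro i j
    simp [PiLp.inner_apply, mul_comm]
  simpa only [e] using h

/-! ### The trilinear form on `ℓ₂` -/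

lemma classicalBound_ge {M : ℕ} (T : Fin M → Fin M → Fin M → ℝ) (a b c : Fin M → ℤˣ) :
    |∑ i, ∑ j, ∑ k, T i j k * sgn (a i) * sgn (b j) * sgn (c k)| ≤ classicalBound T :=
  le_ciSup (f := fun s : (Fin M → ℤˣ) × (Fin M → ℤˣ) × (Fin M → ℤˣ) =>
    |∑ i, ∑ j, ∑ k, T i j k * sgn (s.1 i) * sgn (s.2.1 j) * sgn (s.2.2 k)|)
    (Set.finite_range _).bddAbove (a, b, c)

lemma classicalBound_nonneg {M : ℕ} (T : Fin M → Fin M → Fin M → ℝ) : 0 ≤ classicalBound T :=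
  (abs_nonneg _).trans (classicalBound_ge T 1 1 1)

lemma signNorm₂_contract_le {M : ℕ} (T : Fin M → Fin M → Fin M → ℝ) (c : Fin M → ℤˣ) :
    signNorm₂ (fun i j => ∑ k, T i j k * sgn (c k)) ≤ classicalBound T := by
  refine ciSup_le fun s => (le_of_eq ?_).trans (classicalBound_ge T s.1 s.2 c)
  congr 1
  refine Finset.sum_congr rfl fun i _ => Finset.sum_congr rfl fun j _ => ?_
  rw [Finset.sum_mul, Finset.sum_mul]
  exact Finset.sum_congr rfl fun k _ => by ring

/-- Signs `c k` realising the absolute values contract `T` to a matrix whose sign norm is at most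
`classicalBound T`. -/
lemma sum_abs_contract_le {M : ℕ} (T : Fin M → Fin M → Fin M → ℝ) {ι : Type} [Fintype ι]
    (x y : Fin M → ι → ℝ) (hx : ∀ i, ∑ a, x i a ^ 2 ≤ 1) (hy : ∀ j, ∑ a, y j a ^ 2 ≤ 1) :
    ∑ k, |∑ i, ∑ j, T i j k * ∑ a, x i a * y j a| ≤ grothendieckConstant * classicalBound T := by
  refine sum_abs_le_of_signs _ _ fun c => ?_
  have h := isEuclideanBound_grothendieckConstant (fun i j => ∑ k, T i j k * sgn (c k)) ι x y hx hy
  refine (le_of_eq ?_).trans (h.trans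
    (mul_le_mul_of_nonneg_left (signNorm₂_contract_le T c) grothendieckConstant_nonneg))
  congr 1
  simp only [Finset.mul_sum, Finset.sum_mul]
  rw [Finset.sum_comm]
  refine Finset.sum_congr rfl fun i _ => ?_
  rw [Finset.sum_comm]
  refine Finset.sum_congr rfl fun j _ => ?_
  rw [Finset.sum_comm]
  exact Finset.sum_congr rfl fun a _ => Finset.sum_congr rfl fun k _ => by ring

/-- The vector `∑ i j, T i j k * x i * y j` (pointwise product). -/
noncomputable def contract {M n : ℕ} (T : Fin M → Fin M → Fin M → ℝ) (x y : Fin M → Fin n → ℂ)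
    (k : Fin M) (a : Fin n) : ℂ := ∑ i, ∑ j, (T i j k : ℂ) * (x i a * y j a)

lemma sum_sqrt_le_of_radSum {M n : ℕ} (R : Fin M → Fin n → ℝ) (C : ℝ)
    (h : ∀ ε, ∑ k, |radSum (R k) ε| ≤ C) : ∑ k, √(∑ a, R k a ^ 2) ≤ 16 / 9 * C := by
  have h1 : ∑ ε : Fin n → ℤˣ, ∑ k, |radSum (R k) ε| ≤ 2 ^ n * C := by
    refine (Finset.sum_le_sum fun ε _ => h ε).trans ?_
    simp
  rw [Finset.sum_comm] at h1
  have h2 := (Finset.sum_le_sum fun k (_ : k ∈ Finset.univ) => khintchine (R k)).trans h1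
  rw [← Finset.mul_sum, ← Finset.mul_sum] at h2
  have := le_of_mul_le_mul_left h2 (by positivity)
  linarith

lemma sum_sqrt_re_contract_le {M n : ℕ} (T : Fin M → Fin M → Fin M → ℝ) (x y : Fin M → Fin n → ℂ)
    (hx : ∀ i, ∑ a, ‖x i a‖ ^ 2 ≤ 1) (hy : ∀ j, ∑ a, ‖y j a‖ ^ 2 ≤ 1) :
    ∑ k, √(∑ a, (contract T x y k a).re ^ 2)
      ≤ 16 / 9 * (grothendieckConstant * classicalBound T) := by
  refine sum_sqrt_le_of_radSum (fun k a => (contract T x y k a).re) _ fun ε => ?_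
  have hn : ∀ z : ℂ, ‖z‖ ^ 2 = z.re ^ 2 + z.im ^ 2 := fun z => by
    rw [Complex.sq_norm, Complex.normSq_apply]
    ring
  -- `Re (x * y) = Re x * Re y - Im x * Im y` is a real inner product in doubled dimension; the
  -- factors `ε a` preserve norms.
  have h := sum_abs_contract_le T
    (fun i => Sum.elim (fun a => sgn (ε a) * (x i a).re) fun a => -(sgn (ε a) * (x i a).im))
    (fun j => Sum.elim (fun a => (y j a).re) fun a => (y j a).im)
    (fun i => by
      refine (le_of_eq ?_).trans (hx i)
      simp only [Fintype.sum_sum_type, Sum.elim_inl, Sum.elim_inr, ← Finset.sum_add_distrib]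
      refine Finset.sum_congr rfl fun a _ => ?_
      rw [hn]
      linear_combination ((x i a).re ^ 2 + (x i a).im ^ 2) * sgn_mul_self (ε a))
    (fun j => by
      refine (le_of_eq ?_).trans (hy j)
      simp only [Fintype.sum_sum_type, Sum.elim_inl, Sum.elim_inr, ← Finset.sum_add_distrib]
      exact Finset.sum_congr rfl fun a _ => (hn _).symm)
  refine (le_of_eq ?_).trans h
  refine Finset.sum_congr rfl fun k _ => ?_
  congr 1
  simp only [radSum, contract, Complex.re_sum, Fintype.sum_sum_type, Sum.elim_inl, Sum.elim_inr,
    ← Finset.sum_add_distrib, Finset.mul_sum]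
  rw [Finset.sum_comm]
  refine Finset.sum_congr rfl fun i _ => ?_
  rw [Finset.sum_comm]
  refine Finset.sum_congr rfl fun j _ => Finset.sum_congr rfl fun a _ => ?_
  rw [Complex.re_ofReal_mul, Complex.mul_re]
  ring

lemma sum_sqrt_im_contract_le {M n : ℕ} (T : Fin M → Fin M → Fin M → ℝ) (x y : Fin M → Fin n → ℂ)
    (hx : ∀ i, ∑ a, ‖x i a‖ ^ 2 ≤ 1) (hy : ∀ j, ∑ a, ‖y j a‖ ^ 2 ≤ 1) :
    ∑ k, √(∑ a, (contract T x y k a).im ^ 2)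
      ≤ 16 / 9 * (grothendieckConstant * classicalBound T) := by
  -- Multiplying `x` by `I` turns imaginary parts into real ones, up to sign.
  have h := sum_sqrt_re_contract_le T (fun i a => Complex.I * x i a) y (by simpa using hx) hy
  have e : ∀ k a, contract T (fun i a => Complex.I * x i a) y k a
      = Complex.I * contract T x y k a := by
    intro k a
    simp only [contract, Finset.mul_sum]
    exact Finset.sum_congr rfl fun i _ => Finset.sum_congr rfl fun j _ => by ring
  simpa [e] using h

lemma sum_sqrt_contract_le {M n : ℕ} (T : Fin M → Fin M → Fin M → ℝ) (x y : Fin M → Fin n → ℂ)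
    (hx : ∀ i, ∑ a, ‖x i a‖ ^ 2 ≤ 1) (hy : ∀ j, ∑ a, ‖y j a‖ ^ 2 ≤ 1) :
    ∑ k, √(∑ a, ‖contract T x y k a‖ ^ 2) ≤ 4 * (grothendieckConstant * classicalBound T) := by
  have h1 := sum_sqrt_re_contract_le T x y hx hy
  have h2 := sum_sqrt_im_contract_le T x y hx hy
  have h3 : ∀ k, √(∑ a, ‖contract T x y k a‖ ^ 2)
      ≤ √(∑ a, (contract T x y k a).re ^ 2) + √(∑ a, (contract T x y k a).im ^ 2) := by
    intro k
    have e : ∑ a, ‖contract T x y k a‖ ^ 2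
        = ∑ a, (contract T x y k a).re ^ 2 + ∑ a, (contract T x y k a).im ^ 2 := by
      rw [← Finset.sum_add_distrib]
      refine Finset.sum_congr rfl fun a _ => ?_
      rw [Complex.sq_norm, Complex.normSq_apply]
      ring
    have hr : 0 ≤ ∑ a, (contract T x y k a).re ^ 2 := Finset.sum_nonneg fun _ _ => sq_nonneg _
    have hi : 0 ≤ ∑ a, (contract T x y k a).im ^ 2 := Finset.sum_nonneg fun _ _ => sq_nonneg _
    rw [e]
    refine Real.sqrt_le_iff.2 ⟨by positivity, ?_⟩
    rw [add_sq, Real.sq_sqrt hr, Real.sq_sqrt hi]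
    have : 0 ≤ 2 * √(∑ a, (contract T x y k a).re ^ 2) * √(∑ a, (contract T x y k a).im ^ 2) := by
      positivity
    linarith
  have h4 := Finset.sum_le_sum fun k (_ : k ∈ Finset.univ) => h3 k
  rw [Finset.sum_add_distrib] at h4
  have h5 := mul_nonneg grothendieckConstant_nonneg (classicalBound_nonneg T)
  linarith

lemma sum_rotate {α β γ : Type*} [Fintype α] [Fintype β] [Fintype γ] (f : α → β → γ → ℂ) :
    ∑ i, ∑ j, ∑ k, f i j k = ∑ k, ∑ i, ∑ j, f i j k := by
  simp only [Finset.sum_comm (s := (Finset.univ : Finset β)) (t := (Finset.univ : Finset γ))]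
  exact Finset.sum_comm

lemma sum_rotate₄ {α β γ δ : Type*} [Fintype α] [Fintype β] [Fintype γ] [Fintype δ]
    (f : α → β → γ → δ → ℂ) :
    ∑ r, ∑ i, ∑ j, ∑ k, f r i j k = ∑ i, ∑ j, ∑ k, ∑ r, f r i j k := by
  rw [Finset.sum_comm]
  exact Finset.sum_congr rfl fun i _ => (sum_rotate fun j k r => f r i j k).symm

/-- The trilinear extension of Grothendieck's inequality to the form `∑ a, x a * y a * z a` on the
unit ball of complex `ℓ₂`. -/
theorem norm_trilinear_le {M n : ℕ} (T : Fin M → Fin M → Fin M → ℝ) (x y z : Fin M → Fin n → ℂ)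
    (hx : ∀ i, ∑ a, ‖x i a‖ ^ 2 ≤ 1) (hy : ∀ j, ∑ a, ‖y j a‖ ^ 2 ≤ 1)
    (hz : ∀ k, ∑ a, ‖z k a‖ ^ 2 ≤ 1) :
    ‖∑ i, ∑ j, ∑ k, (T i j k : ℂ) * ∑ a, x i a * y j a * z k a‖
      ≤ 4 * (grothendieckConstant * classicalBound T) := by
  have e : ∑ i, ∑ j, ∑ k, (T i j k : ℂ) * ∑ a, x i a * y j a * z k a
      = ∑ k, ∑ a, contract T x y k a * z k a := by
    rw [sum_rotate]
    refine Finset.sum_congr rfl fun k _ => ?_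
    simp only [contract, Finset.mul_sum, Finset.sum_mul]
    rw [sum_rotate]
    exact Finset.sum_congr rfl fun a _ => Finset.sum_congr rfl fun i _ =>
      Finset.sum_congr rfl fun j _ => by ring
  rw [e]
  refine (norm_sum_le _ _).trans (le_trans (Finset.sum_le_sum fun k _ => ?_)
    (sum_sqrt_contract_le T x y hx hy))
  calc ‖∑ a, contract T x y k a * z k a‖ ≤ ∑ a, ‖contract T x y k a‖ * ‖z k a‖ :=
        (norm_sum_le _ _).trans (le_of_eq (Finset.sum_congr rfl fun _ _ => norm_mul _ _))
    _ ≤ √(∑ a, ‖contract T x y k a‖ ^ 2) * √(∑ a, ‖z k a‖ ^ 2) :=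
        Real.sum_mul_le_sqrt_mul_sqrt _ _ _
    _ ≤ √(∑ a, ‖contract T x y k a‖ ^ 2) :=
        mul_le_of_le_one_right (Real.sqrt_nonneg _) (Real.sqrt_le_one.2 (hz k))

/-! ### The GHZ state -/

lemma IsDichotomic.row_norm_le {d : ℕ} {A : Matrix (Fin d) (Fin d) ℂ} (hA : IsDichotomic A)
    (r : Fin d) : ∑ a, ‖A r a‖ ^ 2 ≤ 1 := by
  obtain ⟨hH, h1, h2⟩ := hA
  have p1 := h2.mul_mul_conjTranspose_same (1 - A)
  have p2 := h1.mul_mul_conjTranspose_same (1 + A)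
  have hs := p1.add p2
  -- Both summands are congruences of positive matrices, so `A * Aᴴ ≤ 1` follows without
  -- diagonalising `A`; its diagonal entries are the squared row norms.
  have e : (1 - A) * (1 + A) * (1 - A).conjTranspose + (1 + A) * (1 - A) * (1 + A).conjTranspose
      = (2 : ℂ) • (1 - A * A.conjTranspose) := by
    rw [h1.1.eq, h2.1.eq, hH.eq, two_smul]
    noncomm_ring
  rw [e] at hs
  have hd := hs.diag_nonneg (i := r)
  have e2 : ((2 : ℂ) • (1 - A * A.conjTranspose)) r r = ((2 * (1 - ∑ a, ‖A r a‖ ^ 2) : ℝ) : ℂ) := by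
    simp [Matrix.mul_apply, Complex.mul_conj, Complex.normSq_eq_norm_sq]
  rw [e2, Complex.zero_le_real] at hd
  linarith

lemma correlation_ghzState {n : ℕ} (A B C : Matrix (Fin n) (Fin n) ℂ) :
    correlation (ghzState n) A B C = (n : ℂ)⁻¹ * ∑ r, ∑ a, A r a * B r a * C r a := by
  have hss : ((1 / Real.sqrt n : ℝ) : ℂ) * ((1 / Real.sqrt n : ℝ) : ℂ) = (n : ℂ)⁻¹ := by
    rw [← Complex.ofReal_mul, div_mul_div_comm, Real.mul_self_sqrt (Nat.cast_nonneg n)]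
    simp
  have h1 : correlation (ghzState n) A B C =
      star (ghzVector n) ⬝ᵥ ((A ⊗ₖ (B ⊗ₖ C)).mulVec (ghzVector n)) := by
    rw [correlation, ghzState, Matrix.vecMulVec_mul, Matrix.trace_vecMulVec,
      Matrix.dotProduct_mulVec, dotProduct_comm]
  rw [h1, ghzVector, Matrix.mulVec_smul, star_smul, smul_dotProduct, dotProduct_smul, smul_smul,
    smul_eq_mul, Complex.star_def, Complex.conj_ofReal, hss, star_sum, Matrix.mulVec_sum,
    sum_dotProduct]
  congr 1
  refine Finset.sum_congr rfl fun r _ => ?_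
  rw [dotProduct_sum]
  refine Finset.sum_congr rfl fun a _ => ?_
  rw [← Pi.single_star, star_one, single_dotProduct]
  simp [Matrix.kroneckerMap_apply, mul_assoc]

theorem isViolationBound_ghzState {n : ℕ} (hn : 1 ≤ n) :
    IsViolationBound (ghzState n) (4 * grothendieckConstant) := by
  intro M T A B C hA hB hC
  have hn0 : (0 : ℝ) < n := by exact_mod_cast hn
  have e : ∑ i, ∑ j, ∑ k, (T i j k : ℂ) * correlation (ghzState n) (A i) (B j) (C k)
      = (n : ℂ)⁻¹ * ∑ r, ∑ i, ∑ j, ∑ k, (T i j k : ℂ) * ∑ a, A i r a * B j r a * C k r a := by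
    rw [sum_rotate₄, Finset.mul_sum]
    refine Finset.sum_congr rfl fun i _ => ?_
    rw [Finset.mul_sum]
    refine Finset.sum_congr rfl fun j _ => ?_
    rw [Finset.mul_sum]
    refine Finset.sum_congr rfl fun k _ => ?_
    rw [correlation_ghzState, ← Finset.mul_sum, mul_left_comm]
  have h : ∀ r, _ := fun r => norm_trilinear_le T (fun i => A i r) (fun j => B j r)
    (fun k => C k r) (fun i => (hA i).row_norm_le r) (fun j => (hB j).row_norm_le r)
    fun k => (hC k).row_norm_le r
  rw [e, norm_mul, norm_inv, Complex.norm_natCast, inv_mul_le_iff₀ hn0]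
  refine (norm_sum_le _ _).trans ((Finset.sum_le_sum fun r _ => h r).trans (le_of_eq ?_))
  simp only [Finset.sum_const, Finset.card_univ, Fintype.card_fin, nsmul_eq_mul]
  ring

lemma largestViolation_le {d₁ d₂ d₃ : ℕ}
    {ρ : Matrix (Fin d₁ × Fin d₂ × Fin d₃) (Fin d₁ × Fin d₂ × Fin d₃) ℂ} {K : ℝ} (hK0 : 0 ≤ K)
    (hK : IsViolationBound ρ K) : largestViolation ρ ≤ ENNReal.ofReal K :=
  iInf₂_le_of_le K.toNNReal (by rwa [Real.coe_toNNReal K hK0]) le_rfl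

end BellViolation

theorem mainTheorem4 (n : ℕ) (hn : 1 ≤ n) :
    BellViolation.largestViolation (BellViolation.ghzState n) ≤
      ENNReal.ofReal (4 * Real.sqrt 2 * BellViolation.grothendieckConstant) := by
  have hK := BellViolation.grothendieckConstant_nonneg
  refine (BellViolation.largestViolation_le (by positivity)
    (BellViolation.isViolationBound_ghzState hn)).trans (ENNReal.ofReal_le_ofReal ?_)
  -- The argument gives `4 * K_G`; the factor `√2` is slack.
  have h2 : 1 ≤ Real.sqrt 2 := Real.one_le_sqrt.2 one_le_two
  exact mul_le_mul_of_nonneg_right (by linarith) hK
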